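/- Let $\mathbb{N}=\{1,2,3,\dots\}$ and let $\mathbb{N}^*=\beta\mathbb{N}\setminus\mathbb{N}$ be the space of free ultrafilters on $\mathbb{N}$. Let $\tau:\mathbb{N}^*\to\mathbb{N}^*$ be the homeomorphism obtained by extending $n\mapsto n+1$ continuously to $\beta\mathbb{N}$ and restricting to $\mathbb{N}^*$. Let $\Omega^*$ be the quotient space of $\mathbb{N}^*\times[0,1]$ in which $(\omega,1)$ is identified with $(\tau\omega,0)$ for every $\omega\in\mathbb{N}^*$, and for $s\in\mathbb{R}$ put $$\phi^s(\omega,t)=(\tau^{\lfloor t+s\rfloor}\omega,\;t+s-\lfloor t+s\rfloor).$$ For $\eta=(\omega,t)\in\Omega^*$ and $\theta=2^t$ put $$\nu_\eta(A)=\omega\text{-}\lim_n\frac{|A\cap\{1,\dots,\lfloor\theta 2^n\rfloor\}|}{\theta 2^n},\qquad A\subseteq\mathbb{N}.$$ Let $\mathcal{D}$ be the set of all $\eta\in\Omega^*$ for which there are a neighborhood $U$ of $\eta$ and a real number $L>0$ such that $\phi^{-s}\eta\notin U$ for every $s>L$. A density measure is a finitely additive probability measure on $\mathcal{P}(\mathbb{N})$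 that extends asymptotic density. Let $\mathcal{C}_0$ be the set of those density measures whose associated normalized positive linear functional $\varphi$ on $\ell^\infty$ (determined by $\varphi(I_A)=$ the measure of $A$) satisfies $\varphi(f)\le\limsup_{n}\frac1n\sum_{i=1}^n f(i)$ for every $f\in\ell^\infty$. A finitely additive probability measure $\nu$ on $\mathcal{P}(\mathbb{N})$ has the additive property if for every increasing sequence $A_1\subseteq A_2\subseteq\cdots$ of subsets of $\mathbb{N}$ there is $B\subseteq\mathbb{N}$ with $\nu(B)=\lim_k\nu(A_k)$ and $\nu(A_k\setminus B)=0$ for every $k$. **Theorem.** Let $\eta\in\mathcal{D}$ and let $\mu$ be a countably additive Borel probability measure on $[0,\infty)$. Then for every $A\subseteq\mathbb{N}$ the function $s\mapsto\nu_{\phi^{-s}\eta}(A)$ is $\mu$-integrable, and $$\nu(A)=\int_0^\infty\nu_{\phi^{-s}\eta}(A)\,d\mu(s),\qquad A\subseteq\mathbb{N},$$ defines a density measure $\nu$ in $\mathcal{C}_0$ which has the additive property. -/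

import Mathlib

open Filter Topology Set MeasureTheory
open scoped NNReal ENNReal unitInterval

/-! Throughout, the natural numbers are `ℕ+ = {1, 2, 3, …}`. -/

namespace DensityMeasure

noncomputable section

/-- `|A ∩ {1, …, N}|`. -/
def count (A : Set ℕ+) (N : ℕ) : ℕ := {k : ℕ+ | k ∈ A ∧ (k : ℕ) ≤ N}.ncard

/-- A finitely additive probability measure on all subsets of the natural numbers. -/
structure IsFinAddProb (ν : Set ℕ+ → ℝ) : Prop where
  nonneg : ∀ A, 0 ≤ ν A
  univ : ν Set.univ = 1
  union : ∀ A B, Disjoint A B → ν (A ∪ B) = ν A + ν B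

/-- `A` has asymptotic density `d`. -/
def HasAsymptoticDensity (A : Set ℕ+) (d : ℝ) : Prop :=
  Tendsto (fun n : ℕ+ => (count A n : ℝ) / (n : ℝ)) atTop (𝓝 d)

/-- A density measure: a finitely additive probability measure extending asymptotic density. -/
structure IsDensityMeasure (ν : Set ℕ+ → ℝ) : Prop extends IsFinAddProb ν where
  extends_density : ∀ A d, HasAsymptoticDensity A d → ν A = d

/-- The Banach space of bounded real functions on the natural numbers. -/
abbrev LInfty : Type := lp (fun _ : ℕ+ => ℝ) ∞

/-- `Φ` is the normalized positive linear functional (integration with respect to `ν`)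
that corresponds to the finitely additive probability measure `ν`:
it sends the characteristic function of each set `A` to `ν A`.
(For a given `ν` there is exactly one such `Φ`; the case `A = univ` is the normalization.) -/
def IsFunctionalOf (Φ : LInfty →ₗ[ℝ] ℝ) (ν : Set ℕ+ → ℝ) : Prop :=
  (∀ f : LInfty, (∀ n, 0 ≤ f n) → 0 ≤ Φ f) ∧
  ∀ (A : Set ℕ+) (f : LInfty), (∀ n, f n = A.indicator (fun _ => (1 : ℝ)) n) → Φ f = ν A

/-- The Cesàro mean `(1/n) ∑_{i=1}^n f(i)`. -/
def cesaro (f : ℕ+ → ℝ) (n : ℕ+) : ℝ := (1 / (n : ℝ)) * ∑ i ∈ Finset.Icc 1 n, f i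

/-- The class `𝒞₀`: density measures whose functional is dominated by the upper Cesàro mean. -/
def IsC0 (ν : Set ℕ+ → ℝ) : Prop :=
  IsDensityMeasure ν ∧
  ∃ Φ : LInfty →ₗ[ℝ] ℝ, IsFunctionalOf Φ ν ∧
    ∀ f : LInfty, Φ f ≤ limsup (cesaro fun n => f n) atTop

/-- The additive property of a finitely additive measure. -/
def HasAdditiveProperty (ν : Set ℕ+ → ℝ) : Prop :=
  ∀ A : ℕ → Set ℕ+, Monotone A →
    ∃ B : Set ℕ+, Tendsto (fun k => ν (A k)) atTop (𝓝 (ν B)) ∧ ∀ k, ν (A k \ B) = 0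

/-- `ℕ* = βℕ \ ℕ`: the free ultrafilters, with the subspace topology from `βℕ`. -/
abbrev NStar : Type := {ω : Ultrafilter ℕ+ // (ω : Filter ℕ+) ≤ cofinite}

theorem map_succ_free (ω : NStar) :
    ((ω.1.map (fun n : ℕ+ => n + 1) : Ultrafilter ℕ+) : Filter ℕ+) ≤ cofinite := by
  rw [Ultrafilter.coe_map]
  exact (Filter.map_mono ω.2).trans
    ((add_left_injective (1 : ℕ+)).tendsto_cofinite)

theorem tendsto_pred_cofinite :
    Tendsto (fun n : ℕ+ => n - 1) cofinite cofinite := by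
  refine Filter.Tendsto.cofinite_of_finite_preimage_singleton fun b => ?_
  refine Set.Finite.subset (Set.finite_Icc 1 (b + 1)) fun n hn => ?_
  have h : n - 1 = b := hn
  refine ⟨one_le, ?_⟩
  rcases eq_or_ne n 1 with rfl | hne
  · exact one_le
  · have h1 : 1 < n := lt_of_le_of_ne (one_le) (Ne.symm hne)
    have := PNat.add_sub_of_lt h1
    rw [h, add_comm] at this
    exact this.ge

theorem map_pred_free (ω : NStar) :
    ((ω.1.map (fun n : ℕ+ => n - 1) : Ultrafilter ℕ+) : Filter ℕ+) ≤ cofinite := by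
  rw [Ultrafilter.coe_map]
  exact (Filter.map_mono ω.2).trans tendsto_pred_cofinite

/-- The bijection `τ` of `ℕ*`: the restriction of the continuous extension to `βℕ`
of the translation `n ↦ n + 1`. That extension is the push-forward of ultrafilters. -/
def tau : Equiv.Perm NStar where
  toFun ω := ⟨ω.1.map fun n => n + 1, map_succ_free ω⟩
  invFun ω := ⟨ω.1.map fun n => n - 1, map_pred_free ω⟩
  left_inv ω := by
    apply Subtype.ext
    apply Ultrafilter.coe_injective
    simp only [Ultrafilter.coe_map, Filter.map_map]
    have : ((fun n : ℕ+ => n - 1) ∘ fun n : ℕ+ => n + 1) = id := by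
      funext n
      simp
    rw [this, Filter.map_id]
  right_inv ω := by
    apply Subtype.ext
    apply Ultrafilter.coe_injective
    simp only [Ultrafilter.coe_map, Filter.map_map]
    have h : ((fun n : ℕ+ => n + 1) ∘ fun n : ℕ+ => n - 1) =ᶠ[(ω.1 : Filter ℕ+)] id := by
      have h1 : ∀ᶠ n : ℕ+ in (ω.1 : Filter ℕ+), n ≠ 1 :=
        ω.2 (Set.finite_singleton (1 : ℕ+)).compl_mem_cofinite
      filter_upwards [h1] with n hn
      have h2 : 1 < n := lt_of_le_of_ne (one_le) (Ne.symm hn)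
      have := PNat.add_sub_of_lt h2
      simpa [add_comm] using this
    rw [Filter.map_congr h, Filter.map_id]

/-- The identification of `(ω, 1)` with `(τ ω, 0)`. -/
inductive Glue : NStar × I → NStar × I → Prop
  | mk (ω : NStar) : Glue (ω, 1) (tau ω, 0)

/-- The space `Ω*`: the quotient of `ℕ* × [0,1]` by the equivalence relation generated by
`(ω, 1) ∼ (τ ω, 0)`, with the quotient topology. -/
abbrev OmegaStar : Type := Quot Glue

/-- The formula `(ω, t) ↦ (τ^⌊t+s⌋ ω, t + s - ⌊t+s⌋)` for the flow. -/
def flowPair (s : ℝ) (p : NStar × I) : NStar × I :=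
  ((tau ^ ⌊(p.2 : ℝ) + s⌋) p.1,
    ⟨Int.fract ((p.2 : ℝ) + s), Int.fract_nonneg _, (Int.fract_lt_one _).le⟩)

theorem flowPair_glue (s : ℝ) (p q : NStar × I) (h : Glue p q) :
    flowPair s p = flowPair s q := by
  cases h with
  | mk ω =>
    unfold flowPair
    refine Prod.ext ?_ (Subtype.ext ?_)
    · simp only [Set.Icc.coe_one, Set.Icc.coe_zero, zero_add]
      rw [add_comm, Int.floor_add_one, zpow_add_one, Equiv.Perm.mul_apply]
    · simp only [Set.Icc.coe_one, Set.Icc.coe_zero, zero_add]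
      rw [add_comm, Int.fract_add_one]

/-- The flow `φ^s` on `Ω*`. -/
def flow (s : ℝ) : OmegaStar → OmegaStar :=
  Quot.lift (fun p => Quot.mk Glue (flowPair s p))
    fun p q h => congrArg (Quot.mk Glue) (flowPair_glue s p q h)

/-- The ratio `|A ∩ [θ 2^n]| / (θ 2^n)` with `θ = 2^t`. -/
def ratio (A : Set ℕ+) (t : ℝ) (n : ℕ+) : ℝ :=
  (count A ⌊(2 : ℝ) ^ t * 2 ^ (n : ℕ)⌋₊ : ℝ) / ((2 : ℝ) ^ t * 2 ^ (n : ℕ))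

/-- `ω-lim_n |A ∩ [θ 2^n]| / (θ 2^n)`, `θ = 2^t`. The sequence is bounded, so its limit along
the ultrafilter `ω` exists (see `tendsto_nuPair`). -/
def nuPair (A : Set ℕ+) (p : NStar × I) : ℝ :=
  limUnder (p.1.1 : Filter ℕ+) (ratio A (p.2 : ℝ))

theorem count_le (A : Set ℕ+) (N : ℕ) : count A N ≤ N := by
  have h : (fun k : ℕ+ => (k : ℕ)) '' {k : ℕ+ | k ∈ A ∧ (k : ℕ) ≤ N} ⊆ Finset.Icc 1 N := by
    rintro _ ⟨k, hk, rfl⟩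
    simpa using ⟨k.pos, hk.2⟩
  have h2 := Set.ncard_le_ncard h (Finset.finite_toSet _)
  rw [Set.ncard_image_of_injective _ PNat.coe_injective, Set.ncard_coe_finset] at h2
  simpa [count] using h2

theorem ratio_mem (A : Set ℕ+) (t : ℝ) (n : ℕ+) : ratio A t n ∈ Set.Icc (0 : ℝ) 1 := by
  have hpos : (0 : ℝ) < (2 : ℝ) ^ t * 2 ^ (n : ℕ) := by positivity
  refine ⟨by unfold ratio; positivity, ?_⟩
  unfold ratio
  rw [div_le_one hpos]
  exact (Nat.cast_le.mpr (count_le A _)).trans (Nat.floor_le hpos.le)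

theorem tendsto_nuPair (A : Set ℕ+) (p : NStar × I) :
    Tendsto (ratio A (p.2 : ℝ)) (p.1.1 : Filter ℕ+) (𝓝 (nuPair A p)) := by
  have h : ((p.1.1.map (ratio A (p.2 : ℝ)) : Ultrafilter ℝ) : Filter ℝ)
      ≤ 𝓟 (Set.Icc (0 : ℝ) 1) := by
    rw [Ultrafilter.coe_map, le_principal_iff]
    exact Filter.mem_map.mpr (Filter.univ_mem' fun n => ratio_mem A _ n)
  obtain ⟨x, -, hx⟩ := isCompact_Icc.ultrafilter_le_nhds _ h
  exact tendsto_nhds_limUnder ⟨x, hx⟩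

theorem nuPair_glue (A : Set ℕ+) (p q : NStar × I) (h : Glue p q) :
    nuPair A p = nuPair A q := by
  cases h with
  | mk ω =>
    have h : ratio A ((1 : I) : ℝ) = ratio A ((0 : I) : ℝ) ∘ fun n : ℕ+ => n + 1 := by
      funext n
      simp [ratio, pow_succ, mul_comm]
    unfold nuPair limUnder
    dsimp only
    rw [h, ← Filter.map_map]
    rfl

/-- The density measure `ν_η` attached to a point `η = (ω, t)` of `Ω*`. -/
def nu (η : OmegaStar) (A : Set ℕ+) : ℝ := Quot.lift (nuPair A) (nuPair_glue A) η

/-- The set `𝒟` of points whose backward orbit is not recurrent. -/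
def NonRecurrent : Set OmegaStar :=
  {η | ∃ U ∈ 𝓝 η, ∃ L : ℝ, 0 < L ∧ ∀ s : ℝ, L < s → flow (-s) η ∉ U}

/-- The set function `A ↦ ∫_0^∞ ν_{φ^{-s} η}(A) dμ(s)`. -/
def mixture (η : OmegaStar) (μ : Measure ℝ≥0) (A : Set ℕ+) : ℝ :=
  ∫ s : ℝ≥0, nu (flow (-(s : ℝ)) η) A ∂μ

end

end DensityMeasure

/-! For `η = (ω, t)` put `F_A(x) = ω-lim 2⁻ⁿ |A ∩ [1, x 2ⁿ]|` (`limitMean`). The flow rescales `x`: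
the measure at `φ^s η` is `F_A(x) / x` with `x = 2^(t+s)` (`nu_flow`). As `F_A` is Lipschitz in `x`,
the integrand is continuous and bounded, hence integrable. Each `F_f(x) / x` is a limit of Cesàro
means of `f`, so it lies below their limsup, and averaging over `μ` keeps this bound; it already
forces membership in `𝒞₀` (`isC0_of_le_limsup`).

For the additive property, non-recurrence yields `W ∈ ω` whose gaps below `n ∈ W` tend to infinity
along `ω` (`exists_gaps_of_nonRecurrent`). Given increasing `A_k`, let `B` agree with `A_{K(n)}` on
the block `(2^(m+1), 2^(n+1)]` between consecutive `m < n` in `W`. The part of `[1, 2^(n+1)]` below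
the block is negligible, so for `x ≤ 2` the set `B` looks like `A_{K(n)}` at scale `2ⁿ`. If `K(n)`
tends to infinity slowly enough, `F_B = lim F_{A_k}` on a countable dense set of such `x`, hence for
all `x ≤ 2` by the Lipschitz bound (`exists_limitMean_additive`). One `B` thus serves every `s ≥ 0`,
and dominated convergence finishes the proof. -/

namespace DensityMeasure

noncomputable section

/-! ### Partial sums and Cesàro means -/

/-- The sum `f 1 + ⋯ + f N`. -/
def partialSum (f : ℕ+ → ℝ) (N : ℕ) : ℝ := ∑ k ∈ Finset.range N, f k.succPNat

/-- The real indicator function of a set. -/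
abbrev ind (A : Set ℕ+) : ℕ+ → ℝ := A.indicator fun _ => (1 : ℝ)

theorem abs_ind_le (A : Set ℕ+) (i : ℕ+) : |ind A i| ≤ 1 := by
  by_cases h : i ∈ A <;> simp [ind, h]

theorem partialSum_ind (A : Set ℕ+) (N : ℕ) : partialSum (ind A) N = count A N := by
  classical
  have h : {k : ℕ+ | k ∈ A ∧ (k : ℕ) ≤ N}
      = (((Finset.range N).filter fun k => k.succPNat ∈ A).image Nat.succPNat : Finset ℕ+) := by
    ext k
    simp only [mem_ofPred_eq, Finset.coe_image, Finset.coe_filter, Finset.mem_range, mem_image]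
    constructor
    · rintro ⟨hA, hN⟩
      refine ⟨k.natPred, ⟨?_, by simpa using hA⟩, by simp⟩
      have := k.natPred_add_one
      omega
    · rintro ⟨m, ⟨hm, hA⟩, rfl⟩
      exact ⟨hA, by simpa using hm⟩
  unfold count partialSum
  rw [h, Set.ncard_coe_finset, Finset.card_image_of_injective _ Nat.succPNat_injective]
  simp [ind, Set.indicator_apply, Finset.sum_boole]

theorem cesaro_eq (f : ℕ+ → ℝ) (n : ℕ+) : cesaro f n = partialSum f n / n := by
  have h : ∑ i ∈ Finset.Icc 1 n, f i = partialSum f n := by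
    refine Finset.sum_bij' (fun i _ => i.natPred) (fun k _ => k.succPNat) ?_ ?_ ?_ ?_ ?_
    · intro i hi
      have h1 : (i : ℕ) ≤ n := (Finset.mem_Icc.mp hi).2
      have := i.natPred_add_one
      simp only [Finset.mem_range]
      omega
    · intro k hk
      refine Finset.mem_Icc.mpr ⟨one_le, ?_⟩
      rw [← PNat.coe_le_coe]
      simpa using hk
    · simp
    · simp
    · simp
  rw [cesaro, h]
  ring

theorem partialSum_add (f g : ℕ+ → ℝ) (N : ℕ) :
    partialSum (f + g) N = partialSum f N + partialSum g N := by
  simp [partialSum, Finset.sum_add_distrib]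

theorem partialSum_smul (c : ℝ) (f : ℕ+ → ℝ) (N : ℕ) :
    partialSum (c • f) N = c * partialSum f N := by
  simp [partialSum, Finset.mul_sum]

theorem abs_partialSum_sub_le {f : ℕ+ → ℝ} {C : ℝ} (hf : ∀ i, |f i| ≤ C) (M N : ℕ) :
    |partialSum f M - partialSum f N| ≤ C * |(M : ℝ) - N| := by
  wlog h : N ≤ M generalizing M N
  · rw [abs_sub_comm, abs_sub_comm (M : ℝ)]
    exact this N M (le_of_not_ge h)
  rw [partialSum, partialSum, ← Finset.sum_Ico_eq_sub _ h]
  refine (Finset.abs_sum_le_sum_abs _ _).trans ?_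
  refine (Finset.sum_le_card_nsmul _ _ C fun i _ => hf _).trans_eq ?_
  rw [Nat.card_Ico, nsmul_eq_mul, Nat.cast_sub h, abs_of_nonneg (by simpa using h), mul_comm]

theorem abs_partialSum_le {f : ℕ+ → ℝ} {C : ℝ} (hf : ∀ i, |f i| ≤ C) (N : ℕ) :
    |partialSum f N| ≤ C * N := by
  simpa [partialSum] using abs_partialSum_sub_le hf N 0

theorem abs_cesaro_le {f : ℕ+ → ℝ} {C : ℝ} (hf : ∀ i, |f i| ≤ C) (n : ℕ+) :
    |cesaro f n| ≤ C := by
  have hn : (0 : ℝ) < n := by exact_mod_cast n.pos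
  rw [cesaro_eq, abs_div, abs_of_pos hn, div_le_iff₀ hn]
  exact abs_partialSum_le hf n

/-! ### Dyadic means and their limits along an ultrafilter -/

/-- The normalized sum `2⁻ⁿ ∑_{i ≤ x 2ⁿ} f(i)`. -/
def dyadicMean (f : ℕ+ → ℝ) (x : ℝ) (n : ℕ+) : ℝ :=
  partialSum f ⌊x * 2 ^ (n : ℕ)⌋₊ / 2 ^ (n : ℕ)

/-- The limit of the normalized sums `2⁻ⁿ ∑_{i ≤ x 2ⁿ} f(i)` along `ω`. -/
def limitMean (ω : NStar) (f : ℕ+ → ℝ) (x : ℝ) : ℝ :=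
  limUnder (ω.1 : Filter ℕ+) (dyadicMean f x)

theorem natFloor_le_abs (x : ℝ) : (⌊x⌋₊ : ℝ) ≤ |x| :=
  (Nat.cast_le.mpr (Nat.floor_mono (le_abs_self x))).trans (Nat.floor_le (abs_nonneg x))

theorem abs_natFloor_sub_le (x y : ℝ) : |(⌊x⌋₊ : ℝ) - ⌊y⌋₊| ≤ |x - y| + 1 := by
  wlog h : y ≤ x generalizing x y
  · rw [abs_sub_comm, abs_sub_comm x]
    exact this y x (le_of_not_ge h)
  rw [abs_of_nonneg (sub_nonneg.mpr (Nat.cast_le.mpr (Nat.floor_mono h))),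
    abs_of_nonneg (sub_nonneg.mpr h)]
  have h1 := Nat.lt_floor_add_one y
  rcases le_total 0 x with hx | hx
  · have := Nat.floor_le hx
    linarith
  · rw [Nat.floor_of_nonpos hx]
    have : (0 : ℝ) ≤ ⌊y⌋₊ := Nat.cast_nonneg _
    push_cast
    linarith

theorem abs_dyadicMean_le {f : ℕ+ → ℝ} {C : ℝ} (hf : ∀ i, |f i| ≤ C) (x : ℝ) (n : ℕ+) :
    |dyadicMean f x n| ≤ C * |x| := by
  have hC : 0 ≤ C := (abs_nonneg _).trans (hf 1)
  have hp : (0 : ℝ) < 2 ^ (n : ℕ) := by positivity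
  rw [dyadicMean, abs_div, abs_of_pos hp, div_le_iff₀ hp]
  refine (abs_partialSum_le hf _).trans ?_
  rw [mul_assoc]
  refine mul_le_mul_of_nonneg_left ((natFloor_le_abs _).trans_eq ?_) hC
  rw [abs_mul, abs_of_pos hp]

theorem tendsto_limitMean (ω : NStar) {f : ℕ+ → ℝ} {C : ℝ} (hf : ∀ i, |f i| ≤ C) (x : ℝ) :
    Tendsto (dyadicMean f x) (ω.1 : Filter ℕ+) (𝓝 (limitMean ω f x)) := by
  have h : ((ω.1.map (dyadicMean f x) : Ultrafilter ℝ) : Filter ℝ)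
      ≤ 𝓟 (Set.Icc (-(C * |x|)) (C * |x|)) := by
    rw [Ultrafilter.coe_map, le_principal_iff]
    exact Filter.mem_map.mpr (Filter.univ_mem' fun n => abs_le.mp (abs_dyadicMean_le hf x n))
  obtain ⟨y, -, hy⟩ := isCompact_Icc.ultrafilter_le_nhds _ h
  exact tendsto_nhds_limUnder ⟨y, hy⟩

theorem abs_limitMean_le (ω : NStar) {f : ℕ+ → ℝ} {C : ℝ} (hf : ∀ i, |f i| ≤ C) (x : ℝ) :
    |limitMean ω f x| ≤ C * |x| :=
  le_of_tendsto (tendsto_limitMean ω hf x).abs (Eventually.of_forall (abs_dyadicMean_le hf x))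

theorem tendsto_coe_atTop (ω : NStar) :
    Tendsto (fun n : ℕ+ => (n : ℕ)) (ω.1 : Filter ℕ+) atTop := by
  rw [← Nat.cofinite_eq_atTop]
  exact PNat.coe_injective.tendsto_cofinite.mono_left ω.2

theorem tendsto_inv_two_pow (ω : NStar) :
    Tendsto (fun n : ℕ+ => ((2 : ℝ) ^ (n : ℕ))⁻¹) (ω.1 : Filter ℕ+) (𝓝 0) :=
  tendsto_inv_atTop_zero.comp
    ((tendsto_pow_atTop_atTop_of_one_lt one_lt_two).comp (tendsto_coe_atTop ω))

/-- The two sums differ in at most `|x - y| 2ⁿ + 1` terms, and the rounding error `1` vanishes after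
division by `2ⁿ`. -/
theorem abs_limitMean_sub_le (ω : NStar) {f : ℕ+ → ℝ} {C : ℝ} (hf : ∀ i, |f i| ≤ C) (x y : ℝ) :
    |limitMean ω f x - limitMean ω f y| ≤ C * |x - y| := by
  have hC : 0 ≤ C := (abs_nonneg _).trans (hf 1)
  have h : Tendsto (fun n : ℕ+ => C * (|x - y| + ((2 : ℝ) ^ (n : ℕ))⁻¹))
      (ω.1 : Filter ℕ+) (𝓝 (C * |x - y|)) := by
    simpa using ((tendsto_inv_two_pow ω).const_add |x - y|).const_mul C
  refine le_of_tendsto_of_tendsto ((tendsto_limitMean ω hf x).sub (tendsto_limitMean ω hf y)).abs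
    h (Eventually.of_forall fun n => ?_)
  have hp : (0 : ℝ) < 2 ^ (n : ℕ) := by positivity
  dsimp only
  rw [dyadicMean, dyadicMean, ← sub_div, abs_div, abs_of_pos hp, div_le_iff₀ hp]
  refine (abs_partialSum_sub_le hf _ _).trans ?_
  rw [mul_assoc, add_mul, inv_mul_cancel₀ hp.ne']
  refine mul_le_mul_of_nonneg_left ((abs_natFloor_sub_le _ _).trans_eq ?_) hC
  rw [← sub_mul, abs_mul, abs_of_pos hp]

theorem continuous_of_abs_sub_le {g : ℝ → ℝ} {C : ℝ} (h : ∀ x y, |g x - g y| ≤ C * |x - y|) :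
    Continuous g :=
  (LipschitzWith.of_dist_le_mul (K := C.toNNReal) fun x y => by
    rw [Real.dist_eq, Real.dist_eq]
    exact (h x y).trans (mul_le_mul_of_nonneg_right (Real.le_coe_toNNReal C) (abs_nonneg _))).continuous

theorem continuous_limitMean (ω : NStar) {f : ℕ+ → ℝ} {C : ℝ} (hf : ∀ i, |f i| ≤ C) :
    Continuous (limitMean ω f) :=
  continuous_of_abs_sub_le (abs_limitMean_sub_le ω hf)

theorem limitMean_add (ω : NStar) {f g : ℕ+ → ℝ} {C D : ℝ} (hf : ∀ i, |f i| ≤ C)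
    (hg : ∀ i, |g i| ≤ D) (x : ℝ) :
    limitMean ω (f + g) x = limitMean ω f x + limitMean ω g x := by
  refine Tendsto.limUnder_eq
    (((tendsto_limitMean ω hf x).add (tendsto_limitMean ω hg x)).congr fun n => ?_)
  rw [dyadicMean, dyadicMean, dyadicMean, partialSum_add, add_div]

theorem limitMean_smul (ω : NStar) {f : ℕ+ → ℝ} {C : ℝ} (hf : ∀ i, |f i| ≤ C) (c x : ℝ) :
    limitMean ω (c • f) x = c * limitMean ω f x := by
  refine Tendsto.limUnder_eq (((tendsto_limitMean ω hf x).const_mul c).congr fun n => ?_)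
  rw [dyadicMean, dyadicMean, partialSum_smul, mul_div_assoc]

/-- The dyadic mean is the Cesàro mean at index `⌊x 2ⁿ⌋` times `⌊x 2ⁿ⌋ / 2ⁿ`, and this factor tends
to `x`. -/
theorem limitMean_div_le_limsup (ω : NStar) {f : ℕ+ → ℝ} {C : ℝ} (hf : ∀ i, |f i| ≤ C) {x : ℝ}
    (hx : 0 < x) : limitMean ω f x / x ≤ limsup (cesaro f) atTop := by
  refine le_of_forall_gt_imp_ge_of_dense fun b hb => ?_
  have hbdd : IsBoundedUnder (· ≤ ·) atTop (cesaro f) :=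
    isBoundedUnder_of ⟨C, fun n => (abs_le.mp (abs_cesaro_le hf n)).2⟩
  have hev : ∀ᶠ n in atTop, cesaro f n < b := eventually_lt_of_limsup_lt hb hbdd
  have hfl : Tendsto (fun n : ℕ+ => ⌊x * 2 ^ (n : ℕ)⌋₊) (ω.1 : Filter ℕ+) atTop :=
    tendsto_nat_floor_atTop.comp (((tendsto_pow_atTop_atTop_of_one_lt one_lt_two).comp
      (tendsto_coe_atTop ω)).const_mul_atTop hx)
  have hfrac : Tendsto (fun n : ℕ+ => b * ((⌊x * 2 ^ (n : ℕ)⌋₊ : ℝ) / 2 ^ (n : ℕ)))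
      (ω.1 : Filter ℕ+) (𝓝 (b * x)) :=
    ((tendsto_nat_floor_mul_div_atTop hx.le).comp ((tendsto_pow_atTop_atTop_of_one_lt
      one_lt_two).comp (tendsto_coe_atTop ω))).const_mul b
  rw [div_le_iff₀ hx]
  refine le_of_tendsto_of_tendsto (tendsto_limitMean ω hf x) hfrac ?_
  obtain ⟨N, hN⟩ := eventually_atTop.mp hev
  filter_upwards [hfl.eventually_ge_atTop (N : ℕ)] with n hn
  have hpos : 0 < ⌊x * 2 ^ (n : ℕ)⌋₊ := N.pos.trans_le hn
  have h := (hN (Nat.toPNat _ hpos) hn).le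
  rw [cesaro_eq] at h
  have hp : (0 : ℝ) < 2 ^ (n : ℕ) := by positivity
  rw [dyadicMean, ← mul_div_assoc]
  refine div_le_div_of_nonneg_right ?_ hp.le
  rwa [div_le_iff₀ (by exact_mod_cast hpos)] at h

/-! ### The flow as a rescaling of `x` -/

/-- Transporting to `ℤ` makes every power of `τ` a genuine translation, with no truncated
subtraction for negative `k`. -/
theorem map_coe_tau_zpow (ω : NStar) (k : ℤ) :
    Filter.map (fun n : ℕ+ => (n : ℤ)) ((tau ^ k) ω).1 =
      Filter.map (fun n : ℕ+ => (n : ℤ) + k) ω.1 := by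
  have step : ∀ ω : NStar, Filter.map (fun n : ℕ+ => (n : ℤ)) (tau ω).1 =
      Filter.map (fun m : ℤ => m + 1) (Filter.map (fun n : ℕ+ => (n : ℤ)) ω.1) := by
    intro ω
    change Filter.map _ ((ω.1.map fun n => n + 1 : Ultrafilter ℕ+) : Filter ℕ+) = _
    rw [Ultrafilter.coe_map, Filter.map_map, Filter.map_map]
    congr 1
  induction k using Int.induction_on with
  | zero => simp
  | succ k ih =>
    rw [add_comm, zpow_add, zpow_one, Equiv.Perm.mul_apply, step, ih, Filter.map_map]
    congr 1
    funext n
    simp only [Function.comp_apply]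
    ring
  | pred k ih =>
    have h := step ((tau ^ (-(k : ℤ) - 1)) ω)
    rw [← Equiv.Perm.mul_apply, ← zpow_one_add, add_sub_cancel, ih] at h
    have h2 := congrArg (Filter.map fun m : ℤ => m - 1) h
    rw [Filter.map_map, Filter.map_map] at h2
    simpa [Function.comp_def, add_sub_assoc] using h2.symm

theorem nu_flow (ω : NStar) (t : I) (s : ℝ) (A : Set ℕ+) :
    nu (flow s (Quot.mk Glue (ω, t))) A
      = limitMean ω (ind A) ((2 : ℝ) ^ ((t : ℝ) + s)) / (2 : ℝ) ^ ((t : ℝ) + s) := by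
  set k : ℤ := ⌊(t : ℝ) + s⌋ with hk
  set r : ℝ := Int.fract ((t : ℝ) + s) with hr
  have hsum : r + k = (t : ℝ) + s := Int.fract_add_floor _
  change nuPair A (flowPair s (ω, t)) = _
  have h1 := tendsto_nuPair A (flowPair s (ω, t))
  change Tendsto (ratio A r) ((tau ^ k) ω).1 _ at h1
  -- The ratio is extended to integer indices so that the shift by a possibly negative `k` can be
  -- substituted.
  let G : ℤ → ℝ := fun m => (count A ⌊(2 : ℝ) ^ (r + m)⌋₊ : ℝ) / (2 : ℝ) ^ (r + m)
  have hG : ratio A r = G ∘ fun n : ℕ+ => (n : ℤ) := by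
    funext n
    simp [ratio, G, Real.rpow_add]
  rw [hG, Tendsto, ← Filter.map_map, map_coe_tau_zpow, Filter.map_map] at h1
  refine tendsto_nhds_unique h1
    (((tendsto_limitMean ω (abs_ind_le A) ((2 : ℝ) ^ ((t : ℝ) + s))).div_const _).congr fun n => ?_)
  have hpow : (2 : ℝ) ^ (r + (((n : ℤ) + k : ℤ) : ℝ)) = (2 : ℝ) ^ ((t : ℝ) + s) * 2 ^ (n : ℕ) := by
    rw [← hsum, Int.cast_add, add_comm ((n : ℤ) : ℝ), ← add_assoc, Real.rpow_add two_pos]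
    simp
  simp only [G, Function.comp_apply, hpow, dyadicMean, partialSum_ind]
  rw [div_div, mul_comm (2 ^ (n : ℕ) : ℝ)]

theorem integrable_limitMean_div (ω : NStar) (t : ℝ) (μ : Measure ℝ≥0) [IsProbabilityMeasure μ]
    {f : ℕ+ → ℝ} {C : ℝ} (hf : ∀ i, |f i| ≤ C) :
    Integrable (fun s : ℝ≥0 =>
      limitMean ω f ((2 : ℝ) ^ (t + -(s : ℝ))) / (2 : ℝ) ^ (t + -(s : ℝ))) μ := by
  have hc : Continuous fun s : ℝ≥0 => (2 : ℝ) ^ (t + -(s : ℝ)) :=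
    (Real.continuous_const_rpow two_ne_zero).comp (by fun_prop)
  have hm := ((continuous_limitMean ω hf).comp hc).div hc
    fun s => (Real.rpow_pos_of_pos two_pos _).ne'
  refine Integrable.of_bound (C := C) hm.aestronglyMeasurable (Eventually.of_forall fun s => ?_)
  have hp : (0 : ℝ) < (2 : ℝ) ^ (t + -(s : ℝ)) := Real.rpow_pos_of_pos two_pos _
  rw [Real.norm_eq_abs, abs_div, abs_of_pos hp, div_le_iff₀ hp]
  simpa only [abs_of_pos hp] using abs_limitMean_le ω hf ((2 : ℝ) ^ (t + -(s : ℝ)))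

/-! ### Membership in `𝒞₀` -/

theorem LInfty.abs_apply_le (f : LInfty) (i : ℕ+) : |f i| ≤ ‖f‖ :=
  lp.norm_apply_le_norm ENNReal.top_ne_zero f i

/-- The indicator function of a set as a bounded function. -/
def indLInfty (A : Set ℕ+) : LInfty :=
  ⟨ind A, memℓp_infty ⟨1, by rintro _ ⟨i, rfl⟩; exact abs_ind_le A i⟩⟩

/-- The bound applied to `-f` gives positivity; applied to an indicator and its negative, it
squeezes the value to the density when that exists. Normalization is the case of density `1`. -/
theorem isC0_of_le_limsup {ν : Set ℕ+ → ℝ} (Φ : LInfty →ₗ[ℝ] ℝ)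
    (hν : ∀ A, Φ (indLInfty A) = ν A)
    (hΦ : ∀ f : LInfty, Φ f ≤ limsup (cesaro fun n => f n) atTop) : IsC0 ν := by
  have hpos : ∀ f : LInfty, (∀ n, 0 ≤ f n) → 0 ≤ Φ f := by
    intro f hf
    have h1 := hΦ (-f)
    rw [map_neg] at h1
    have h2 : limsup (cesaro fun n => (-f) n) atTop ≤ 0 := by
      refine limsup_le_of_le (IsBoundedUnder.isCoboundedUnder_le (isBoundedUnder_of
        ⟨-‖-f‖, fun n => (abs_le.mp (abs_cesaro_le (LInfty.abs_apply_le (-f)) n)).1⟩))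
        (Eventually.of_forall fun n => ?_)
      refine mul_nonpos_of_nonneg_of_nonpos (by positivity) (Finset.sum_nonpos fun i _ => ?_)
      simpa using hf i
    linarith
  have hfun : IsFunctionalOf Φ ν := by
    refine ⟨hpos, fun A f hf => ?_⟩
    rw [← hν A]
    congr 1
    ext n
    exact hf n
  have hdens : ∀ A d, HasAsymptoticDensity A d → ν A = d := by
    intro A d hA
    have h1 : Tendsto (cesaro fun n => indLInfty A n) atTop (𝓝 d) := by
      refine hA.congr fun n => ?_
      rw [cesaro_eq, ← partialSum_ind]
      rfl
    have h2 : Tendsto (cesaro fun n => (-indLInfty A) n) atTop (𝓝 (-d)) := by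
      refine h1.neg.congr fun n => ?_
      simp only [cesaro, lp.coeFn_neg, Pi.neg_apply, Finset.sum_neg_distrib, mul_neg]
    have h3 := hΦ (indLInfty A)
    have h4 := hΦ (-indLInfty A)
    rw [h1.limsup_eq, hν] at h3
    rw [h2.limsup_eq, map_neg, hν] at h4
    linarith
  refine ⟨⟨⟨fun A => ?_, ?_, fun A B hAB => ?_⟩, hdens⟩, Φ, hfun, hΦ⟩
  · rw [← hν]
    exact hpos _ fun n => Set.indicator_nonneg (fun _ _ => zero_le_one) n
  · refine hdens _ _ (tendsto_const_nhds.congr fun n => ?_)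
    have hn : (n : ℝ) ≠ 0 := by exact_mod_cast n.ne_zero
    rw [← partialSum_ind]
    simp [partialSum, ind, hn]
  · rw [← hν, ← hν, ← hν, ← map_add]
    congr 1
    ext n
    exact congrFun (Set.indicator_union_of_disjoint hAB fun _ => (1 : ℝ)) n

/-- The functional `f ↦ ∫ ω-lim_n (x 2ⁿ)⁻¹ ∑_{i ≤ x 2ⁿ} f(i) dμ(s)`, where `x = 2^(t-s)`. -/
def mixtureFunctional (ω : NStar) (t : ℝ) (μ : Measure ℝ≥0) [IsProbabilityMeasure μ] :
    LInfty →ₗ[ℝ] ℝ where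
  toFun f := ∫ s : ℝ≥0,
    limitMean ω f ((2 : ℝ) ^ (t + -(s : ℝ))) / (2 : ℝ) ^ (t + -(s : ℝ)) ∂μ
  map_add' f g := by
    rw [← integral_add (integrable_limitMean_div ω t μ f.abs_apply_le)
      (integrable_limitMean_div ω t μ g.abs_apply_le)]
    congr 1
    funext s
    rw [← add_div, ← limitMean_add ω f.abs_apply_le g.abs_apply_le]
    rfl
  map_smul' c f := by
    rw [RingHom.id_apply, smul_eq_mul, ← integral_const_mul]
    congr 1
    funext s
    rw [← mul_div_assoc, ← limitMean_smul ω f.abs_apply_le]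
    rfl

theorem isC0_mixture (ω : NStar) (t : I) (μ : Measure ℝ≥0) [IsProbabilityMeasure μ] :
    IsC0 (mixture (Quot.mk Glue (ω, t)) μ) := by
  refine isC0_of_le_limsup (mixtureFunctional ω t μ) (fun A => ?_) fun f => ?_
  · simp only [mixture, nu_flow]
    rfl
  · have h := integral_mono (integrable_limitMean_div ω t μ f.abs_apply_le)
      (integrable_const (limsup (cesaro fun n => f n) atTop))
      fun s => limitMean_div_le_limsup ω f.abs_apply_le (Real.rpow_pos_of_pos two_pos _)
    rw [integral_const, probReal_univ, one_smul] at h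
    exact h

/-! ### Non-recurrence and gaps -/

theorem flow_neg_natCast (ω : NStar) (t : I) (j : ℕ) :
    flow (-(j : ℝ)) (Quot.mk Glue (ω, t)) = Quot.mk Glue ((tau ^ (-(j : ℤ))) ω, t) := by
  change Quot.mk Glue (flowPair (-(j : ℝ)) (ω, t)) = _
  rcases eq_or_lt_of_le t.2.2 with h | h
  · have ht : t = 1 := Subtype.ext h
    subst ht
    rw [Quot.sound (Glue.mk ((tau ^ (-(j : ℤ))) ω))]
    congr 1
    unfold flowPair
    have hsum : ((1 : I) : ℝ) + -(j : ℝ) = ((1 + -(j : ℤ) : ℤ) : ℝ) := by push_cast; rfl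
    refine Prod.ext ?_ (Subtype.ext ?_)
    · simp only [hsum, Int.floor_intCast]
      rw [zpow_one_add, Equiv.Perm.mul_apply]
    · simp only [hsum, Int.fract_intCast, Set.Icc.coe_zero]
  · congr 1
    unfold flowPair
    have hsum : (t : ℝ) + -(j : ℝ) = (t : ℝ) + ((-(j : ℤ) : ℤ) : ℝ) := by push_cast; rfl
    refine Prod.ext ?_ (Subtype.ext ?_)
    · simp only [hsum, Int.floor_add_intCast]
      rw [Int.floor_eq_zero_iff.mpr ⟨t.2.1, h⟩, zero_add]
    · simp only [hsum, Int.fract_add_intCast]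
      exact Int.fract_eq_self.mpr ⟨t.2.1, h⟩

theorem exists_mem_subset_of_mem_nhds {ω : NStar} {V : Set NStar} (hV : V ∈ 𝓝 ω) :
    ∃ W ∈ ω.1, ∀ ω' : NStar, W ∈ ω'.1 → ω' ∈ V := by
  rw [nhds_subtype_eq_comap, mem_comap] at hV
  obtain ⟨T, hT, hTV⟩ := hV
  obtain ⟨_, ⟨W, rfl⟩, hW, hWT⟩ := ultrafilterBasis_is_basis.mem_nhds_iff.mp hT
  exact ⟨W, hW, fun ω' h => hTV (hWT h)⟩

/-- The hypothesis says that `n - j ∉ W` for `ω`-most `n`; the additive form also covers `n ≤ j`. -/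
theorem notMem_tau_zpow_neg {ω : NStar} {W : Set ℕ+} {j : ℕ}
    (h : W ∉ ((tau ^ (-(j : ℤ))) ω).1) : ∀ᶠ n : ℕ+ in ω.1, ∀ m ∈ W, (m : ℕ) + j ≠ n := by
  have h1 : Wᶜ ∈ ((tau ^ (-(j : ℤ))) ω).1 := Ultrafilter.compl_mem_iff_notMem.mpr h
  have h2 : {z : ℤ | ∀ m ∈ W, (m : ℤ) ≠ z} ∈
      Filter.map (fun n : ℕ+ => (n : ℤ)) ((tau ^ (-(j : ℤ))) ω).1 := by
    refine mem_map.mpr (mem_of_superset h1 fun n hn m hm hmn => hn ?_)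
    have : m = n := PNat.coe_injective (Int.ofNat_injective hmn)
    exact this ▸ hm
  rw [map_coe_tau_zpow] at h2
  filter_upwards [mem_map.mp h2] with n hn m hm hmn
  exact hn m hm (show (m : ℤ) = n + -(j : ℤ) by omega)

theorem exists_residue_mem (ω : NStar) {J : ℕ} (hJ : 0 < J) :
    ∃ r : ℕ, {n : ℕ+ | (n : ℕ) % J = r} ∈ ω.1 := by
  obtain ⟨a, ha⟩ := Ultrafilter.eq_pure_of_finite
    (ω.1.map fun n : ℕ+ => (⟨(n : ℕ) % J, Nat.mod_lt _ hJ⟩ : Fin J))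
  refine ⟨a, ?_⟩
  have h : {a} ∈ ω.1.map fun n : ℕ+ => (⟨(n : ℕ) % J, Nat.mod_lt _ hJ⟩ : Fin J) := by
    rw [ha]
    exact rfl
  refine mem_of_superset (Ultrafilter.mem_map.mp h) fun n hn => ?_
  exact congrArg Fin.val hn

/-- If `(ω, t)` has a non-recurrent backward orbit, then some member of `ω` has, along `ω`,
arbitrarily long gaps below its elements. -/
theorem exists_gaps_of_nonRecurrent {ω : NStar} {t : I}
    (h : Quot.mk Glue (ω, t) ∈ NonRecurrent) :
    ∃ W ∈ ω.1, ∀ M : ℕ, ∀ᶠ n : ℕ+ in ω.1, ∀ m ∈ W, m < n → (m : ℕ) + M ≤ n := by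
  obtain ⟨U, hU, L, -, hL⟩ := h
  have hU' : Quot.mk Glue ⁻¹' U ∈ 𝓝 (ω, t) := continuous_quot_mk.continuousAt hU
  rw [nhds_prod_eq] at hU'
  obtain ⟨V, hV, V', hV', hVU⟩ := mem_prod_iff.mp hU'
  obtain ⟨W, hW, hWV⟩ := exists_mem_subset_of_mem_nhds hV
  obtain ⟨J, hJ⟩ := exists_nat_gt L
  -- Non-recurrence only excludes differences above `J`. Restricting to one residue class modulo `J
  -- + 1` excludes the differences from `1` to `J`.
  obtain ⟨r, hr⟩ := exists_residue_mem ω (Nat.succ_pos J)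
  refine ⟨W ∩ {n : ℕ+ | (n : ℕ) % (J + 1) = r}, inter_mem hW hr, fun M => ?_⟩
  -- Integer times leave `t` fixed, so `W ∈ τ^(-j) ω` would bring the orbit back into `U` at time `j
  -- > L`.
  have hfar : ∀ j : ℕ, J < j → ∀ᶠ n : ℕ+ in ω.1, ∀ m ∈ W, (m : ℕ) + j ≠ n := by
    intro j hj
    refine notMem_tau_zpow_neg fun hmem => ?_
    refine hL j (hJ.trans (by exact_mod_cast hj)) ?_
    rw [flow_neg_natCast]
    exact hVU ⟨hWV _ hmem, mem_of_mem_nhds hV'⟩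
  have hall : ∀ᶠ n : ℕ+ in ω.1, ∀ j ∈ Finset.Ioo J M, ∀ m ∈ W, (m : ℕ) + j ≠ n :=
    (Filter.eventually_all_finset _).mpr fun j hj => hfar j (Finset.mem_Ioo.mp hj).1
  filter_upwards [hall, hr] with n hn hnr m hm hmn
  by_contra hlt
  have hmn' : (m : ℕ) < n := hmn
  rcases le_or_gt ((n : ℕ) - m) J with hle | hgt
  · have hmod : (m : ℕ) ≡ n [MOD (J + 1)] := hm.2.trans (Eq.symm hnr)
    have hdvd := (Nat.modEq_iff_dvd' hmn'.le).mp hmod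
    have := Nat.le_of_dvd (by omega) hdvd
    omega
  · exact hn (n - m) (Finset.mem_Ioo.mpr ⟨hgt, by omega⟩) m hm.1 (by omega)

/-! ### Sets that agree on long blocks -/

theorem partialSum_sub (f g : ℕ+ → ℝ) (N : ℕ) :
    partialSum f N - partialSum g N = partialSum (f - g) N := by
  simp [partialSum]

/-- Two sets that agree on `(2^(n+1-M), 2^(n+1)]` have nearly equal partial sums
up to `2^(n+1)`. -/
theorem abs_dyadicMean_ind_sub_le {C D : Set ℕ+} {n : ℕ+} {M : ℕ}
    (h : ∀ i : ℕ+, 2 ^ ((n : ℕ) + 1) < 2 ^ M * (i : ℕ) → (i : ℕ) ≤ 2 ^ ((n : ℕ) + 1) →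
      (i ∈ C ↔ i ∈ D)) {x : ℝ} (hx : x ≤ 2) :
    |dyadicMean (ind C) x n - dyadicMean (ind D) x n| ≤ 2 * (1 / 2) ^ M := by
  classical
  have hp : (0 : ℝ) < 2 ^ (n : ℕ) := by positivity
  have hN : ⌊x * 2 ^ (n : ℕ)⌋₊ ≤ 2 ^ ((n : ℕ) + 1) := by
    refine Nat.floor_le_of_le ?_
    push_cast
    rw [pow_succ']
    exact mul_le_mul_of_nonneg_right hx hp.le
  rw [dyadicMean, dyadicMean, ← sub_div, abs_div, abs_of_pos hp, div_le_iff₀ hp, partialSum_sub]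
  generalize ⌊x * 2 ^ (n : ℕ)⌋₊ = N at hN
  refine (Finset.abs_sum_le_sum_abs _ _).trans ?_
  have hterm : ∀ k ∈ Finset.range N, |(ind C - ind D) k.succPNat| ≤
      if 2 ^ M * (k + 1) ≤ 2 ^ ((n : ℕ) + 1) then 1 else 0 := by
    intro k hk
    have hkN := Finset.mem_range.mp hk
    split_ifs with hlt
    · by_cases h1 : k.succPNat ∈ C <;> by_cases h2 : k.succPNat ∈ D <;> simp [ind, h1, h2]
    · have := h k.succPNat (by simpa using hlt) (by simpa using hkN.trans_le hN)
      by_cases h1 : k.succPNat ∈ C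
      · simp [ind, h1, this.mp h1]
      · simp [ind, h1, mt this.mpr h1]
  refine (Finset.sum_le_sum hterm).trans ?_
  rw [Finset.sum_boole]
  -- The sets can differ only at points `k + 1 ≤ 2^(n+1) / 2^M`.
  have hsub : (Finset.range N).filter (fun k => 2 ^ M * (k + 1) ≤ 2 ^ ((n : ℕ) + 1)) ⊆
      Finset.range (2 ^ ((n : ℕ) + 1) / 2 ^ M) := by
    intro k hk
    rw [Finset.mem_range, Nat.lt_iff_add_one_le, Nat.le_div_iff_mul_le (by positivity), mul_comm]
    exact (Finset.mem_filter.mp hk).2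
  have hcard := Finset.card_le_card hsub
  rw [Finset.card_range] at hcard
  refine (Nat.cast_le.mpr hcard).trans (Nat.cast_div_le.trans_eq ?_)
  push_cast
  rw [one_div, inv_pow, pow_succ]
  ring

theorem tendsto_dyadicMean_ind_sub (ω : NStar) {C : Set ℕ+} {D : ℕ+ → Set ℕ+}
    (h : ∀ M : ℕ, ∀ᶠ n : ℕ+ in ω.1, ∀ i : ℕ+, 2 ^ ((n : ℕ) + 1) < 2 ^ M * (i : ℕ) →
      (i : ℕ) ≤ 2 ^ ((n : ℕ) + 1) → (i ∈ C ↔ i ∈ D n)) {x : ℝ} (hx : x ≤ 2) :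
    Tendsto (fun n => dyadicMean (ind C) x n - dyadicMean (ind (D n)) x n)
      (ω.1 : Filter ℕ+) (𝓝 0) := by
  have hM : Tendsto (fun M : ℕ => 2 * (1 / 2 : ℝ) ^ M) atTop (𝓝 0) := by
    simpa using (tendsto_pow_atTop_nhds_zero_of_lt_one (by norm_num : (0 : ℝ) ≤ 1 / 2)
      (by norm_num)).const_mul 2
  refine Metric.tendsto_nhds.mpr fun ε hε => ?_
  obtain ⟨M, hMε⟩ := (hM.eventually_lt_const hε).exists
  filter_upwards [h M] with n hn
  rw [dist_zero_right, Real.norm_eq_abs]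
  exact (abs_dyadicMean_ind_sub_le hn hx).trans_lt hMε

theorem ind_mono {A B : Set ℕ+} (h : A ⊆ B) (i : ℕ+) : ind A i ≤ ind B i :=
  Set.indicator_le_indicator_of_subset h (fun _ => zero_le_one) i

theorem limitMean_ind_mono (ω : NStar) {A B : Set ℕ+} (h : A ⊆ B) (x : ℝ) :
    limitMean ω (ind A) x ≤ limitMean ω (ind B) x :=
  le_of_tendsto_of_tendsto' (tendsto_limitMean ω (abs_ind_le A) x)
    (tendsto_limitMean ω (abs_ind_le B) x) fun n =>
      div_le_div_of_nonneg_right (Finset.sum_le_sum fun k _ => ind_mono h _) (by positivity)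

theorem limitMean_ind_empty (ω : NStar) (x : ℝ) : limitMean ω (ind ∅) x = 0 := by
  refine Tendsto.limUnder_eq (tendsto_const_nhds.congr fun n => ?_)
  simp [dyadicMean, partialSum, ind]

/-! ### Diagonal construction and the additive property -/

/-- A diagonal choice of indices: there is an index function that tends to infinity along `ω` and
realizes the limits of countably many families at once. -/
theorem exists_diagonal_index (ω : NStar) (a : ℕ → ℕ → ℕ+ → ℝ) (l : ℕ → ℕ → ℝ) (g : ℕ → ℝ)
    (ha : ∀ k i, Tendsto (a k i) (ω.1 : Filter ℕ+) (𝓝 (l k i)))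
    (hl : ∀ i, Tendsto (fun k => l k i) atTop (𝓝 (g i))) :
    ∃ K : ℕ+ → ℕ, Tendsto K (ω.1 : Filter ℕ+) atTop ∧
      ∀ i, Tendsto (fun n => a (K n) i n) (ω.1 : Filter ℕ+) (𝓝 (g i)) := by
  classical
  let P : ℕ+ → ℕ → Prop := fun n k => ∀ i ∈ Finset.range k, |a k i n - l k i| < 1 / ((k : ℝ) + 1)
  have hP : ∀ k, ∀ᶠ n : ℕ+ in ω.1, P n k := fun k =>
    (Filter.eventually_all_finset _).mpr fun i _ => by
      have := Metric.tendsto_nhds.mp (ha k i) _ (Nat.one_div_pos_of_nat (n := k))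
      simpa only [Real.dist_eq] using this
  -- `K n` is the largest admissible index up to `n`; index `0` is always admissible because its
  -- condition is vacuous.
  let K : ℕ+ → ℕ := fun n => Nat.findGreatest (P n) n
  have hPK : ∀ n, P n (K n) := fun n =>
    Nat.findGreatest_spec (m := 0) (Nat.zero_le _) (by simp [P])
  have hK : Tendsto K (ω.1 : Filter ℕ+) atTop := by
    refine tendsto_atTop.mpr fun k => ?_
    filter_upwards [hP k, (tendsto_coe_atTop ω).eventually_ge_atTop k] with n hn hkn
    exact Nat.le_findGreatest hkn hn
  refine ⟨K, hK, fun i => ?_⟩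
  have h1 : Tendsto (fun n => a (K n) i n - l (K n) i) (ω.1 : Filter ℕ+) (𝓝 0) := by
    refine squeeze_zero_norm' ?_ (tendsto_one_div_add_atTop_nhds_zero_nat.comp hK)
    filter_upwards [hK.eventually_gt_atTop i] with n hn
    exact (hPK n i (Finset.mem_range.mpr hn)).le
  simpa using h1.add ((hl i).comp hK)

/-- The set that agrees with `D n` on the block `(2^(m+1), 2^(n+1)]` whenever
`m < n` are consecutive elements of `W`. -/
def blockUnion (W : Set ℕ+) (D : ℕ+ → Set ℕ+) : Set ℕ+ :=
  {i | ∃ n ∈ W, (i : ℕ) ≤ 2 ^ ((n : ℕ) + 1) ∧ (∀ m ∈ W, m < n → 2 ^ ((m : ℕ) + 1) < (i : ℕ)) ∧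
    i ∈ D n}

theorem mem_blockUnion_iff {W : Set ℕ+} {D : ℕ+ → Set ℕ+} {n : ℕ+} (hn : n ∈ W) {M : ℕ}
    (hgap : ∀ m ∈ W, m < n → (m : ℕ) + M ≤ n) {i : ℕ+}
    (h1 : 2 ^ ((n : ℕ) + 1) < 2 ^ M * (i : ℕ)) (h2 : (i : ℕ) ≤ 2 ^ ((n : ℕ) + 1)) :
    i ∈ blockUnion W D ↔ i ∈ D n := by
  have hbelow : ∀ m ∈ W, m < n → 2 ^ ((m : ℕ) + 1) < (i : ℕ) := by
    intro m hm hmn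
    have h3 : 2 ^ M * 2 ^ ((m : ℕ) + 1) ≤ 2 ^ ((n : ℕ) + 1) := by
      rw [← pow_add]
      exact Nat.pow_le_pow_right two_pos (by have := hgap m hm hmn; omega)
    exact lt_of_mul_lt_mul_left (h3.trans_lt h1) (Nat.zero_le _)
  refine ⟨?_, fun h => ⟨n, hn, h2, hbelow, h⟩⟩
  rintro ⟨n', hn', h2', hbelow', h⟩
  rcases lt_trichotomy n n' with hlt | rfl | hlt
  · exact absurd (hbelow' n hn hlt) h2.not_gt
  · exact h
  · exact absurd (hbelow n' hn' hlt) h2'.not_gt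

/-- A simultaneous additive property of all the functionals `A ↦ limitMean ω (ind A) x`. -/
theorem exists_limitMean_additive (ω : NStar) {W : Set ℕ+} (hW : W ∈ ω.1)
    (hgap : ∀ M : ℕ, ∀ᶠ n : ℕ+ in ω.1, ∀ m ∈ W, m < n → (m : ℕ) + M ≤ n)
    {A : ℕ → Set ℕ+} (hA : Monotone A) :
    ∃ B : Set ℕ+, ∀ x : ℝ, x ≤ 2 →
      Tendsto (fun k => limitMean ω (ind (A k)) x) atTop (𝓝 (limitMean ω (ind B) x)) ∧
      ∀ k, limitMean ω (ind (A k \ B)) x = 0 := by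
  have hlim : ∀ x, ∃ y, Tendsto (fun k => limitMean ω (ind (A k)) x) atTop (𝓝 y) := fun x =>
    ⟨_, tendsto_atTop_ciSup (fun k k' h => limitMean_ind_mono ω (hA h) x)
      ⟨1 * |x|, by
        rintro _ ⟨k, rfl⟩
        exact (abs_le.mp (abs_limitMean_le ω (abs_ind_le _) x)).2⟩⟩
  choose g hg using hlim
  -- Truncating a dense sequence at `2` gives countably many test points, dense in `(-∞, 2]`.
  let z : ℕ → ℝ := fun i => min (TopologicalSpace.denseSeq ℝ i) 2
  obtain ⟨K, hK, hdiag⟩ := exists_diagonal_index ω (fun k i => dyadicMean (ind (A k)) (z i))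
    (fun k i => limitMean ω (ind (A k)) (z i)) (fun i => g (z i))
    (fun k i => tendsto_limitMean ω (abs_ind_le _) _) (fun i => hg (z i))
  let B := blockUnion W fun n => A (K n)
  have hagree : ∀ M : ℕ, ∀ᶠ n : ℕ+ in ω.1, ∀ i : ℕ+, 2 ^ ((n : ℕ) + 1) < 2 ^ M * (i : ℕ) →
      (i : ℕ) ≤ 2 ^ ((n : ℕ) + 1) → (i ∈ B ↔ i ∈ A (K n)) := by
    intro M
    filter_upwards [hW, hgap M] with n hn hgn i h1 h2
    exact mem_blockUnion_iff hn hgn h1 h2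
  have hBz : ∀ i, limitMean ω (ind B) (z i) = g (z i) := by
    intro i
    refine tendsto_nhds_unique (tendsto_limitMean ω (abs_ind_le B) (z i)) ?_
    have hz : z i ≤ 2 := min_le_right _ _
    simpa using (tendsto_dyadicMean_ind_sub ω hagree hz).add (hdiag i)
  -- The Lipschitz constant does not depend on `k`, so it passes to the limit `g`.
  have hgc : Continuous g := continuous_of_abs_sub_le fun x y =>
    le_of_tendsto ((hg x).sub (hg y)).abs
      (Eventually.of_forall fun k => abs_limitMean_sub_le ω (abs_ind_le (A k)) x y)
  have hmin : Continuous fun x : ℝ => min x 2 := continuous_id.min continuous_const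
  have heq : (fun x => limitMean ω (ind B) (min x 2)) = fun x => g (min x 2) :=
    Continuous.ext_on (TopologicalSpace.denseRange_denseSeq ℝ)
      ((continuous_limitMean ω (abs_ind_le B)).comp hmin) (hgc.comp hmin)
      (by rintro _ ⟨i, rfl⟩; exact hBz i)
  refine ⟨B, fun x hx => ⟨?_, fun k => ?_⟩⟩
  · have := congrFun heq x
    simp only [min_eq_left hx] at this
    rw [this]
    exact hg x
  -- Once `K n ≥ k`, `A k ⊆ A (K n)`, which agrees with `B` on the block, so `A k \ B` is empty
  -- there.
  · have hsub := tendsto_dyadicMean_ind_sub ω (C := A k \ B) (D := fun _ => ∅) (fun M => by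
      filter_upwards [hagree M, hK.eventually_ge_atTop k] with n hn hkn i h1 h2
      simp only [Set.mem_sdiff, mem_empty_iff_false, iff_false, not_and, not_not]
      exact fun hi => (hn i h1 h2).mpr (hA hkn hi)) hx
    have h0 := (tendsto_limitMean ω (abs_ind_le (A k \ B)) x).sub
      (tendsto_limitMean ω (abs_ind_le ∅) x)
    have := tendsto_nhds_unique h0 hsub
    rwa [limitMean_ind_empty, sub_zero] at this

theorem hasAdditiveProperty_mixture {ω : NStar} {t : I}
    (h : Quot.mk Glue (ω, t) ∈ NonRecurrent) (μ : Measure ℝ≥0) [IsProbabilityMeasure μ] :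
    HasAdditiveProperty (mixture (Quot.mk Glue (ω, t)) μ) := by
  obtain ⟨W, hW, hgap⟩ := exists_gaps_of_nonRecurrent h
  intro A hA
  obtain ⟨B, hB⟩ := exists_limitMean_additive ω hW hgap hA
  -- Since `t ≤ 1` and `s ≥ 0`, only `x ≤ 2` occurs, the range where `B` is controlled.
  have hle : ∀ s : ℝ≥0, (2 : ℝ) ^ ((t : ℝ) + -(s : ℝ)) ≤ 2 := fun s => by
    have h1 : (t : ℝ) + -(s : ℝ) ≤ 1 := by
      have := t.2.2
      have := s.2
      linarith
    simpa using Real.rpow_le_rpow_of_exponent_le one_le_two h1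
  refine ⟨B, ?_, fun k => ?_⟩
  · simp only [mixture, nu_flow]
    refine tendsto_integral_of_dominated_convergence (fun _ => 1)
      (fun k => (integrable_limitMean_div ω t μ (abs_ind_le (A k))).aestronglyMeasurable)
      (integrable_const 1) (fun k => Eventually.of_forall fun s => ?_)
      (Eventually.of_forall fun s => ((hB _ (hle s)).1).div_const _)
    have hp : (0 : ℝ) < (2 : ℝ) ^ ((t : ℝ) + -(s : ℝ)) := Real.rpow_pos_of_pos two_pos _
    rw [Real.norm_eq_abs, abs_div, abs_of_pos hp, div_le_iff₀ hp]
    simpa only [abs_of_pos hp] using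
      abs_limitMean_le ω (abs_ind_le (A k)) ((2 : ℝ) ^ ((t : ℝ) + -(s : ℝ)))
  · simp only [mixture, nu_flow, (hB _ (hle _)).2 k, zero_div, integral_zero]

end

end DensityMeasure

theorem theorem4p8 (η : DensityMeasure.OmegaStar) (hη : η ∈ DensityMeasure.NonRecurrent)
    (μ : Measure ℝ≥0) [IsProbabilityMeasure μ] :
    (∀ A : Set ℕ+,
      Integrable (fun s : ℝ≥0 => DensityMeasure.nu (DensityMeasure.flow (-(s : ℝ)) η) A) μ) ∧
    DensityMeasure.IsC0 (DensityMeasure.mixture η μ) ∧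
    DensityMeasure.HasAdditiveProperty (DensityMeasure.mixture η μ) := by
  obtain ⟨⟨ω, t⟩, rfl⟩ := Quot.exists_rep η
  refine ⟨fun A => ?_, DensityMeasure.isC0_mixture ω t μ,
    DensityMeasure.hasAdditiveProperty_mixture hη μ⟩
  simp only [DensityMeasure.nu_flow]
  exact DensityMeasure.integrable_limitMean_div ω t μ (DensityMeasure.abs_ind_le A)
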